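/- Let $d\ge 1$. Let $\phi$ be a Schwartz function on $\mathbb{R}^d$ whose Fourier transform $\widehat\phi(\xi)=\int_{\mathbb{R}^d} \phi(x)e^{-2\pi i\langle x,\xi\rangle}\,dx$ is supported in $\{\xi: 2^{-1}\le|\xi|\le 2\}$ and such that $\sum_{k\in\mathbb{Z}}\widehat{\phi_k}(\xi)=1$ for all $\xi\neq 0$, where $\phi_k:=2^{kd}\phi(2^k\cdot)$. Define $\Phi$ by $\widehat\Phi:=1-\sum_{k=1}^\infty\widehat{\phi_k}$, and for a tempered distribution $f$ on $\mathbb{R}^d$ put $\Lambda_0 f:=\Phi*f$ and $\Lambda_k f:=\phi_k*f$ for $k\ge 1$. For $0<p<\infty$ and $\sigma\in\mathbb{R}$ let $B_p^{\sigma,\infty}$ be the space of tempered distributions $f$ with $$\Vert f\Vert_{B_p^{\sigma,\infty}}:=\sup_{k\ge 0}\Vert 2^{\sigma k}\Lambda_k f\Vert_{L^p}<\infty .$$ For $\sigma\in\mathbb{R}$ and $0<q\le\infty$ let $F_\infty^{\sigma,q}$ be the space of tempered distributions $f$ with $\Vert f\Vert_{F_\infty^{\sigma,q}}<\infty$, where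 $$\Vert f\Vert_{F_\infty^{\sigma,q}}:=\Vert\Lambda_0 f\Vert_{L^\infty}+\sup_{\mu\ge 1}\ \sup_{P\in\mathcal{D}_\mu}\Big(\frac1{|P|}\int_P\sum_{k=\mu}^\infty 2^{\sigma kq}|\Lambda_k f(x)|^q\,dx\Big)^{1/q}\quad(q<\infty),$$ $$\Vert f\Vert_{F_\infty^{\sigma,\infty}}:=\Big\Vert \sup_{k\ge 0}2^{\sigma k}|\Lambda_k f|\Big\Vert_{L^\infty},$$ and $\mathcal{D}_\mu$ is the set of dyadic cubes $\prod_{i=1}^d[2^{-\mu}n_i,2^{-\mu}(n_i+1))$, $n\in\mathbb{Z}^d$, of side length $2^{-\mu}$. **Theorem.** Let $0<p_0<\infty$, $0<q\le\infty$, $s_0\in\mathbb{R}$ and $s=s_0-d/p_0$. Then $$B_{p_0}^{s_0,\infty}\hookrightarrow F_\infty^{s,q},$$ that is, $B_{p_0}^{s_0,\infty}\subseteq F_\infty^{s,q}$ and there is a constant $C<\infty$, independent of $f$, such that $\Vert f\Vert_{F_\infty^{s,q}}\le C\Vert f\Vert_{B_{p_0}^{s_0,\infty}}$ for all $f\in B_{p_0}^{s_0,\infty}$.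 -/

import Mathlib

open MeasureTheory Set
open scoped SchwartzMap FourierTransform ENNReal NNReal

noncomputable section

namespace BesovTL

/-- The Euclidean space `ℝᵈ`. -/
abbrev Rd (d : ℕ) : Type := EuclideanSpace ℝ (Fin d)

/-- The dilation `y ↦ 2 ^ k • y` of `ℝᵈ`. -/
def dyadicScaling (d : ℕ) (k : ℤ) : Rd d ≃L[ℝ] Rd d :=
  ContinuousLinearEquiv.smulLeft (Units.mk0 ((2 : ℝ) ^ k) (by positivity))

/-- The `L¹`-normalized dyadic dilate `φ_k := 2 ^ (k d) φ(2 ^ k ·)`. -/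
def dyadicDilate {d : ℕ} (φ : 𝓢(Rd d, ℂ)) (k : ℤ) : 𝓢(Rd d, ℂ) :=
  ((2 : ℝ) ^ (k * (d : ℤ))) •
    SchwartzMap.compCLMOfContinuousLinearEquiv ℂ (dyadicScaling d k) φ

theorem dyadicDilate_apply {d : ℕ} (φ : 𝓢(Rd d, ℂ)) (k : ℤ) (x : Rd d) :
    dyadicDilate φ k x = ((2 : ℝ) ^ (k * (d : ℤ))) • φ ((2 : ℝ) ^ k • x) := rfl

/-- The convolution of a Schwartz function `g` with a tempered distribution `f`, which is the
(smooth) function `x ↦ f (g (x - ·))`. -/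
def conv {d : ℕ} (g : 𝓢(Rd d, ℂ)) (f : 𝓢'(Rd d, ℂ)) (x : Rd d) : ℂ :=
  f (SchwartzMap.compSubConstCLM ℂ x
    (SchwartzMap.compCLMOfContinuousLinearEquiv ℂ (ContinuousLinearEquiv.neg ℝ) g))

/-- The Schwartz function in the definition of `conv` is `y ↦ g (x - y)`. -/
theorem conv_kernel_apply {d : ℕ} (g : 𝓢(Rd d, ℂ)) (x y : Rd d) :
    SchwartzMap.compSubConstCLM ℂ x
      (SchwartzMap.compCLMOfContinuousLinearEquiv ℂ (ContinuousLinearEquiv.neg ℝ) g) y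
      = g (x - y) := by
  simp

/-- A Littlewood-Paley decomposition of `ℝᵈ`: a function `φ` whose Fourier transform is supported
in `{1/2 ≤ |ξ| ≤ 2}`, with `∑_{k ∈ ℤ} 𝓕 φ_k (ξ) = 1` for `ξ ≠ 0`, together with the function `Φ`
determined by `𝓕 Φ = 1 - ∑_{k ≥ 1} 𝓕 φ_k` (a smooth function supported in `{|ξ| ≤ 2}`, the sums
being locally finite away from the origin). -/
structure LittlewoodPaley (d : ℕ) where
  φ : 𝓢(Rd d, ℂ)
  Φ : 𝓢(Rd d, ℂ)
  tsupport_fourier_φ : tsupport ⇑(𝓕 φ : 𝓢(Rd d, ℂ)) ⊆ {ξ | 2⁻¹ ≤ ‖ξ‖ ∧ ‖ξ‖ ≤ 2}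
  hasSum_fourier_φ : ∀ ξ : Rd d, ξ ≠ 0 → HasSum (fun k : ℤ => (𝓕 (dyadicDilate φ k) : 𝓢(Rd d, ℂ)) ξ) 1
  fourier_Φ : ∀ ξ : Rd d, (𝓕 Φ : 𝓢(Rd d, ℂ)) ξ =
    1 - ∑' k : ℕ, (𝓕 (dyadicDilate φ ((k : ℤ) + 1)) : 𝓢(Rd d, ℂ)) ξ

namespace LittlewoodPaley

variable {d : ℕ} (L : LittlewoodPaley d)

/-- `Λ₀ f = Φ * f`, and `Λ_k f = φ_k * f` for `k ≥ 1`. -/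
def Lam (k : ℕ) (f : 𝓢'(Rd d, ℂ)) : Rd d → ℂ :=
  conv (if k = 0 then L.Φ else dyadicDilate L.φ (k : ℤ)) f

end LittlewoodPaley

/-- The half-open dyadic cube `∏ᵢ [2 ^ (-μ) nᵢ, 2 ^ (-μ) (nᵢ + 1))`, of side length `2 ^ (-μ)`. -/
def dyadicCube {d : ℕ} (μ : ℤ) (n : Fin d → ℤ) : Set (Rd d) :=
  {x | ∀ i, (2 : ℝ) ^ (-μ) * (n i : ℝ) ≤ x i ∧ x i < (2 : ℝ) ^ (-μ) * ((n i : ℝ) + 1)}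

/-- The `ℓ^q` quasi-norm of a sequence, `0 < q ≤ ∞`. -/
def seqNorm (q : ℝ≥0∞) (a : ℕ → ℝ≥0∞) : ℝ≥0∞ :=
  if q = ∞ then ⨆ k, a k else (∑' k, a k ^ q.toReal) ^ (1 / q.toReal)

/-- The quasi-norm of the inhomogeneous Besov space `B_p^{s,q}`, `0 < p, q ≤ ∞`: the `ℓ^q(L^p)`
quasi-norm of `(2 ^ (s k) Λ_k f)_{k ≥ 0}`. -/
def besovNorm {d : ℕ} (L : LittlewoodPaley d) (p : ℝ≥0∞) (s : ℝ) (q : ℝ≥0∞)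
    (f : 𝓢'(Rd d, ℂ)) : ℝ≥0∞ :=
  seqNorm q fun k =>
    eLpNorm (fun x => (((2 : ℝ) ^ (s * k) : ℝ) : ℂ) * L.Lam k f x) p volume

/-- The quasi-norm of the inhomogeneous Triebel-Lizorkin space `F_∞^{s,q}`, `0 < q ≤ ∞`.
For `q = ∞` it is the `L^∞(ℓ^∞)` norm of `(2 ^ (s k) Λ_k f)_{k ≥ 0}`. For `q < ∞` it is the sum of
`‖Λ₀ f‖_{L^∞}` and of the supremum, over the dyadic cubes `P` of side length `2 ^ (-μ) < 1`, of
`(|P|⁻¹ ∫_P ∑_{k ≥ μ} 2 ^ (s k q) |Λ_k f (x)| ^ q dx) ^ (1/q)`. -/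
def triebelLizorkinInftyNorm {d : ℕ} (L : LittlewoodPaley d) (s : ℝ) (q : ℝ≥0∞)
    (f : 𝓢'(Rd d, ℂ)) : ℝ≥0∞ :=
  if q = ∞ then
    essSup (fun x => ⨆ k : ℕ, ENNReal.ofReal ((2 : ℝ) ^ (s * k)) * ‖L.Lam k f x‖ₑ) volume
  else
    eLpNorm (L.Lam 0 f) ∞ volume +
      ⨆ (μ : ℕ) (_ : 1 ≤ μ) (n : Fin d → ℤ),
        ((volume (dyadicCube (μ : ℤ) n))⁻¹ *
          ∫⁻ x in dyadicCube (μ : ℤ) n, ∑' k : Ici μ,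
            ENNReal.ofReal ((2 : ℝ) ^ (s * (k : ℕ) * q.toReal)) *
              ‖L.Lam (k : ℕ) f x‖ₑ ^ q.toReal) ^ (1 / q.toReal)

/-- The space of the tempered distributions on which an extended quasi-norm is finite. -/
def spaceOf {d : ℕ} (N : 𝓢'(Rd d, ℂ) → ℝ≥0∞) : Set 𝓢'(Rd d, ℂ) := {f | N f < ∞}

/-- The Besov space `B_p^{s,q}`. -/
def besovSpace {d : ℕ} (L : LittlewoodPaley d) (p : ℝ≥0∞) (s : ℝ) (q : ℝ≥0∞) :
    Set 𝓢'(Rd d, ℂ) := spaceOf (besovNorm L p s q)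

/-- The Triebel-Lizorkin space `F_∞^{s,q}`. -/
def triebelLizorkinInftySpace {d : ℕ} (L : LittlewoodPaley d) (s : ℝ) (q : ℝ≥0∞) :
    Set 𝓢'(Rd d, ℂ) := spaceOf (triebelLizorkinInftyNorm L s q)

end BesovTL

end

/-! Write `B` for the Besov norm, `p` for the exponent `p₀`, and `H_k = 2 ^ (s k) |Λ_k f|`. Since `s
p = s₀ p - d`, the Besov bound says `∫ H_k ^ p ≤ 2 ^ (-k d) B ^ p`. As `Λ_k f` has frequencies in a
ball of radius `2 ^ (k + 1)`, the Plancherel-Polya-Nikolskii inequality (`exists_enorm_Lam_rpow_le`)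
turns this into `H_k ^ p ≤ C B ^ p` pointwise, uniformly in `k`; both bounds are in
`exists_weighted_Lam_bounds`. The second one settles `q = ∞` and the term `Λ₀ f`.

For `q < ∞` take a cube `P` of side `2 ^ (-m)` and `k ≥ m`. Then `∫ H_k ^ p ≤ 2 ^ (-(k - m) d) |P| B
^ p`, and `exists_average_rpow_le` deduces that the mean of `H_k ^ q` over `P` decays geometrically
in `k - m`, whatever the order of `p` and `q`. Summing the geometric series gives the Carleson-type
bound.

The Nikolskii inequality rests on `Λ_k f = ψ_k * Λ_k f` with a fixed Schwartz `ψ`. Hölder suffices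
for `p > 1`. For `p ≤ 1` a power of the supremum is absorbed, which requires that supremum to be
finite beforehand; this comes from the polynomial growth of `Λ_k f`. The reproducing formula itself
needs a distribution to pass under an integral (`apply_convolution_eq_integral`): the distribution
is factored through a Banach space, where Bochner integration applies. -/

noncomputable section

/-- Hahn-Banach: a linear form bounded by the norm of a linear map factors through that map. -/
theorem LinearMap.exists_continuousLinearMap_comp_eq {V X : Type*} [AddCommGroup V] [Module ℂ V]
    [NormedAddCommGroup X] [NormedSpace ℂ X] (f : V →ₗ[ℂ] ℂ) (T : V →ₗ[ℂ] X) (C : ℝ)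
    (h : ∀ v, ‖f v‖ ≤ C * ‖T v‖) : ∃ g : X →L[ℂ] ℂ, ∀ v, f v = g (T v) := by
  have hker : LinearMap.ker T ≤ LinearMap.ker f := by
    intro v hv
    have := h v
    rw [LinearMap.mem_ker.1 hv, norm_zero, mul_zero] at this
    exact norm_le_zero_iff.1 this
  let g₀ : LinearMap.range T →ₗ[ℂ] ℂ :=
    (LinearMap.ker T).liftQ f hker ∘ₗ T.quotKerEquivRange.symm.toLinearMap
  have hg₀ : ∀ v, g₀ ⟨T v, v, rfl⟩ = f v := fun v => by
    have : T.quotKerEquivRange.symm ⟨T v, v, rfl⟩ = (LinearMap.ker T).mkQ v :=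
      T.quotKerEquivRange_symm_apply_image v _
    change (LinearMap.ker T).liftQ f hker (T.quotKerEquivRange.symm ⟨T v, v, rfl⟩) = f v
    rw [this]
    rfl
  let g₁ : LinearMap.range T →L[ℂ] ℂ := g₀.mkContinuous C <| by
    rintro ⟨-, v, rfl⟩
    rw [hg₀]
    exact h v
  obtain ⟨g, hg, -⟩ := exists_extension_norm_eq (LinearMap.range T) g₁
  exact ⟨g, fun v => (hg₀ v).symm.trans (hg ⟨T v, v, rfl⟩).symm⟩

namespace SchwartzMap

open Filter Topology LineDeriv

/-! ### Translates of a Schwartz function: growth and continuity. -/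

section Translation

variable {E : Type*} [NormedAddCommGroup E] [NormedSpace ℝ E]

theorem iteratedFDeriv_compSubConstCLM (b : 𝓢(E, ℂ)) (n : ℕ) (y x : E) :
    iteratedFDeriv ℝ n (compSubConstCLM ℂ y b) x = iteratedFDeriv ℝ n b (x - y) := by
  have : ⇑(compSubConstCLM ℂ y b) = fun x => b (x - y) := rfl
  rw [this, iteratedFDeriv_comp_sub]

/-- The Schwartz seminorms of a translate grow at most polynomially in the translation. -/
theorem exists_seminorm_compSubConstCLM_le (b : 𝓢(E, ℂ)) (k n : ℕ) :
    ∃ C : ℝ, 0 ≤ C ∧ ∀ y : E,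
      SchwartzMap.seminorm ℂ k n (compSubConstCLM ℂ y b) ≤ C * (1 + ‖y‖) ^ k := by
  refine ⟨2 ^ k * (Finset.Iic (k, n)).sup (fun m => SchwartzMap.seminorm ℂ m.1 m.2) b,
    by positivity, fun y => ?_⟩
  refine seminorm_le_bound ℂ k n _ (by positivity) fun x => ?_
  rw [iteratedFDeriv_compSubConstCLM]
  have h := one_add_le_sup_seminorm_apply (𝕜 := ℂ) (m := (k, n)) le_rfl le_rfl b (x - y)
  have hx : ‖x‖ ≤ (1 + ‖x - y‖) * (1 + ‖y‖) := by
    have := norm_add_le (x - y) y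
    rw [sub_add_cancel] at this
    nlinarith [norm_nonneg (x - y), norm_nonneg y]
  calc ‖x‖ ^ k * ‖iteratedFDeriv ℝ n b (x - y)‖
      ≤ ((1 + ‖x - y‖) * (1 + ‖y‖)) ^ k * ‖iteratedFDeriv ℝ n b (x - y)‖ := by gcongr
    _ = ((1 + ‖x - y‖) ^ k * ‖iteratedFDeriv ℝ n b (x - y)‖) * (1 + ‖y‖) ^ k := by
        rw [mul_pow]; ring
    _ ≤ _ := by gcongr

/-- Mean value inequality on the segment from `x` to `x - h`, at the cost of one more derivative.
The segment stays within distance 1 of `x`, so the weight `‖x‖ ^ k` is controlled by `(1 + ‖z‖) ^ k`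
at each of its points `z`. -/
theorem exists_seminorm_compSubConstCLM_sub_le (b : 𝓢(E, ℂ)) (k n : ℕ) :
    ∃ C : ℝ, 0 ≤ C ∧ ∀ h : E, ‖h‖ ≤ 1 →
      SchwartzMap.seminorm ℂ k n (compSubConstCLM ℂ h b - b) ≤ C * ‖h‖ := by
  set S := 2 ^ k * (Finset.Iic (k, n + 1)).sup (fun m => SchwartzMap.seminorm ℂ m.1 m.2) b with hS
  refine ⟨S, by positivity, fun h hh => ?_⟩
  refine seminorm_le_bound ℂ k n _ (by positivity) fun x => ?_
  have hsub : iteratedFDeriv ℝ n (compSubConstCLM ℂ h b - b : 𝓢(E, ℂ)) x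
      = iteratedFDeriv ℝ n b (x - h) - iteratedFDeriv ℝ n b x := by
    rw [← iteratedFDeriv_compSubConstCLM]
    exact iteratedFDeriv_sub_apply ((compSubConstCLM ℂ h b).contDiffAt n) (b.contDiffAt n)
  rw [hsub]
  have hbd : ∀ z ∈ segment ℝ x (x - h), ‖fderiv ℝ (iteratedFDeriv ℝ n b) z‖ * ‖x‖ ^ k ≤ S := by
    intro z hz
    have h1 : ‖x - z‖ ≤ 1 := by
      obtain ⟨t, ht, rfl⟩ := (segment_eq_image' ℝ x (x - h)) ▸ hz
      have : x - (x + t • (x - h - x)) = t • h := by module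
      rw [this, norm_smul, Real.norm_of_nonneg ht.1]
      nlinarith [ht.1, ht.2, norm_nonneg h]
    have h2 : ‖x‖ ≤ 1 + ‖z‖ := by
      have := norm_add_le (x - z) z
      rw [sub_add_cancel] at this
      linarith
    have h3 := one_add_le_sup_seminorm_apply (𝕜 := ℂ) (m := (k, n + 1)) le_rfl le_rfl b z
    rw [norm_fderiv_iteratedFDeriv, mul_comm]
    refine le_trans ?_ h3
    gcongr
  have hd : Differentiable ℝ (iteratedFDeriv ℝ n b) :=
    (b.smooth ⊤).differentiable_iteratedFDeriv (mod_cast ENat.natCast_lt_top n)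
  -- The derivative bound used below is `S / ‖x‖ ^ k`, which is meaningless when the weight
  -- vanishes.
  rcases eq_or_ne (‖x‖ ^ k) 0 with h0 | h0
  · rw [h0, zero_mul]
    positivity
  · have hpos : 0 < ‖x‖ ^ k := lt_of_le_of_ne (by positivity) (Ne.symm h0)
    have := (convex_segment x (x - h)).norm_image_sub_le_of_norm_fderiv_le (𝕜 := ℝ)
      (fun z _ => hd z) (C := S / ‖x‖ ^ k) (fun z hz => (le_div_iff₀ hpos).2 (hbd z hz))
      (left_mem_segment ℝ x (x - h)) (right_mem_segment ℝ x (x - h))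
    rw [sub_sub_cancel_left, norm_neg] at this
    calc ‖x‖ ^ k * ‖iteratedFDeriv ℝ n b (x - h) - iteratedFDeriv ℝ n b x‖
        ≤ ‖x‖ ^ k * (S / ‖x‖ ^ k * ‖h‖) := by gcongr
      _ = S * ‖h‖ := by field_simp

theorem continuous_compSubConstCLM (b : 𝓢(E, ℂ)) :
    Continuous fun y : E => compSubConstCLM ℂ y b := by
  have h0 : Tendsto (fun h : E => compSubConstCLM ℂ h b) (𝓝 0) (𝓝 b) := by
    refine ((schwartz_withSeminorms ℂ E ℂ).tendsto_nhds _ b).2 fun m ε hε => ?_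
    obtain ⟨C, hC, h⟩ := exists_seminorm_compSubConstCLM_sub_le b m.1 m.2
    have h1 : ∀ᶠ h : E in 𝓝 0, ‖h‖ < min 1 (ε / (C + 1)) :=
      continuous_norm.tendsto' (0 : E) 0 norm_zero |>.eventually_lt_const
        (lt_min one_pos (by positivity))
    filter_upwards [h1] with y hy
    refine (h y (hy.le.trans (min_le_left _ _))).trans_lt ?_
    have h2 := hy.trans_le (min_le_right _ _)
    rw [lt_div_iff₀ (by positivity)] at h2
    nlinarith [norm_nonneg y]
  refine continuous_iff_continuousAt.2 fun y => ?_
  have h1 : Tendsto (fun z : E => z - y) (𝓝 y) (𝓝 0) := by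
    simpa using (continuous_sub_right y).tendsto y
  -- Translation by `z` is translation by `z - y` followed by translation by `y`, so continuity at 0
  -- suffices.
  have := ((compSubConstCLM ℂ y).continuous.tendsto b).comp (h0.comp h1)
  refine this.congr fun z => ?_
  simp

end Translation

/-! ### Factoring tempered distributions through Banach spaces of weighted derivatives. -/

section WeightedDeriv

variable {E : Type*} [NormedAddCommGroup E] [NormedSpace ℝ E]

/-- The function `x ↦ ‖x‖ ^ k • D ^ n f x`, whose sup norm is the seminorm of `f` of
index `(k, n)`. -/
def weightedDeriv (k n : ℕ) (f : 𝓢(E, ℂ)) :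
    BoundedContinuousFunction E (E [×n]→L[ℝ] ℂ) :=
  BoundedContinuousFunction.ofNormedAddCommGroup
    (fun x => ‖x‖ ^ k • iteratedFDeriv ℝ n f x)
    ((continuous_norm.pow k).smul
      ((f.smooth ⊤).continuous_iteratedFDeriv (mod_cast le_top)))
    (SchwartzMap.seminorm ℂ k n f) fun x => by
      rw [norm_smul, norm_pow, norm_norm]
      exact le_seminorm ℂ k n f x

theorem weightedDeriv_apply (k n : ℕ) (f : 𝓢(E, ℂ)) (x : E) :
    weightedDeriv k n f x = ‖x‖ ^ k • iteratedFDeriv ℝ n f x := rfl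

theorem norm_weightedDeriv (k n : ℕ) (f : 𝓢(E, ℂ)) :
    ‖weightedDeriv k n f‖ = SchwartzMap.seminorm ℂ k n f := by
  refine le_antisymm ?_ ?_
  · exact BoundedContinuousFunction.norm_ofNormedAddCommGroup_le _ (by positivity) _
  · refine seminorm_le_bound ℂ k n f (norm_nonneg (weightedDeriv k n f)) fun x => ?_
    have := (weightedDeriv k n f).norm_coe_le_norm x
    rwa [weightedDeriv_apply, norm_smul, norm_pow, norm_norm] at this

/-- `SchwartzMap.weightedDeriv` as a linear map. -/
def weightedDerivLM (k n : ℕ) :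
    𝓢(E, ℂ) →ₗ[ℂ] BoundedContinuousFunction E (E [×n]→L[ℝ] ℂ) where
  toFun := weightedDeriv k n
  map_add' f g := by
    ext1 x
    have : iteratedFDeriv ℝ n (f + g : 𝓢(E, ℂ)) x
        = iteratedFDeriv ℝ n f x + iteratedFDeriv ℝ n g x :=
      iteratedFDeriv_add_apply (f.contDiffAt n) (g.contDiffAt n)
    rw [BoundedContinuousFunction.add_apply]
    simp only [weightedDeriv_apply, this, smul_add]
  map_smul' c f := by
    ext1 x
    have : iteratedFDeriv ℝ n (c • f : 𝓢(E, ℂ)) x = c • iteratedFDeriv ℝ n f x :=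
      iteratedFDeriv_const_smul_apply (f.contDiffAt n)
    rw [RingHom.id_apply, BoundedContinuousFunction.smul_apply]
    simp only [weightedDeriv_apply, this, smul_comm c]

variable (E) in
/-- The Banach space in which finitely many weighted derivatives of a Schwartz function live. -/
def WeightedJet (s : Finset (ℕ × ℕ)) : Type _ :=
  (i : s) → BoundedContinuousFunction E (E [×i.1.2]→L[ℝ] ℂ)

instance (s : Finset (ℕ × ℕ)) : NormedAddCommGroup (WeightedJet E s) :=
  inferInstanceAs (NormedAddCommGroup ((i : s) → BoundedContinuousFunction E (E [×i.1.2]→L[ℝ] ℂ)))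

instance (s : Finset (ℕ × ℕ)) : NormedSpace ℂ (WeightedJet E s) :=
  inferInstanceAs (NormedSpace ℂ ((i : s) → BoundedContinuousFunction E (E [×i.1.2]→L[ℝ] ℂ)))

instance (s : Finset (ℕ × ℕ)) : CompleteSpace (WeightedJet E s) :=
  inferInstanceAs (CompleteSpace ((i : s) → BoundedContinuousFunction E (E [×i.1.2]→L[ℝ] ℂ)))

namespace WeightedJet

theorem norm_apply_le {s : Finset (ℕ × ℕ)} (u : WeightedJet E s) (i : s) : ‖u i‖ ≤ ‖u‖ :=
  norm_le_pi_norm (G := fun i : s => BoundedContinuousFunction E (E [×i.1.2]→L[ℝ] ℂ)) u i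

theorem norm_le {s : Finset (ℕ × ℕ)} (u : WeightedJet E s) {C : ℝ} (hC : 0 ≤ C)
    (h : ∀ i, ‖u i‖ ≤ C) : ‖u‖ ≤ C :=
  (pi_norm_le_iff_of_nonneg
    (G := fun i : s => BoundedContinuousFunction E (E [×i.1.2]→L[ℝ] ℂ)) hC).2 h

theorem ext_apply {s : Finset (ℕ × ℕ)} {u w : WeightedJet E s}
    (h : ∀ i x v, u i x v = w i x v) : u = w := by
  funext i
  ext x v
  exact h i x v

/-- The evaluation of a component of a jet at a point and at a family of vectors. -/
def eval {s : Finset (ℕ × ℕ)} (i : s) (x : E) (v : Fin i.1.2 → E) : WeightedJet E s →L[ℂ] ℂ :=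
  LinearMap.mkContinuous
    { toFun := fun u => u i x v, map_add' := fun _ _ => rfl, map_smul' := fun _ _ => rfl }
    (∏ j, ‖v j‖) fun u => by
      refine ((u i x).le_opNorm v).trans ?_
      rw [mul_comm]
      gcongr
      exact ((u i).norm_coe_le_norm x).trans (norm_apply_le u i)

end WeightedJet

/-- The finite product of the maps `SchwartzMap.weightedDeriv`. -/
def weightedDerivPi (s : Finset (ℕ × ℕ)) : 𝓢(E, ℂ) →ₗ[ℂ] WeightedJet E s where
  toFun f i := weightedDeriv i.1.1 i.1.2 f
  map_add' f g := funext fun i => (weightedDerivLM i.1.1 i.1.2).map_add f g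
  map_smul' c f := funext fun i => (weightedDerivLM i.1.1 i.1.2).map_smul c f

theorem weightedDerivPi_apply (s : Finset (ℕ × ℕ)) (f : 𝓢(E, ℂ)) (i : s) :
    weightedDerivPi s f i = weightedDeriv i.1.1 i.1.2 f := rfl

theorem sup_seminorm_le_norm_weightedDerivPi (s : Finset (ℕ × ℕ)) (f : 𝓢(E, ℂ)) :
    s.sup (schwartzSeminormFamily ℂ E ℂ) f ≤ ‖weightedDerivPi s f‖ := by
  refine Seminorm.finset_sup_apply_le (norm_nonneg _) fun i hi => ?_
  rw [schwartzSeminormFamily_apply, ← norm_weightedDeriv]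
  exact WeightedJet.norm_apply_le (weightedDerivPi s f) ⟨i, hi⟩

theorem norm_weightedDerivPi_le_sum (s : Finset (ℕ × ℕ)) (f : 𝓢(E, ℂ)) :
    ‖weightedDerivPi s f‖ ≤ ∑ i : s, SchwartzMap.seminorm ℂ i.1.1 i.1.2 f := by
  refine WeightedJet.norm_le _ (Finset.sum_nonneg fun i _ => apply_nonneg _ _) fun i => ?_
  rw [weightedDerivPi_apply, norm_weightedDeriv]
  exact Finset.single_le_sum (f := fun i : s => SchwartzMap.seminorm ℂ i.1.1 i.1.2 f)
    (fun i _ => apply_nonneg _ _) (Finset.mem_univ i)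

theorem continuous_weightedDerivPi (s : Finset (ℕ × ℕ)) :
    Continuous (weightedDerivPi (E := E) s) := by
  refine continuous_pi fun i => ?_
  change Continuous (weightedDerivLM (E := E) i.1.1 i.1.2)
  refine WithSeminorms.continuous_normedSpace_rng (𝕝 := ℂ) (𝕝₂ := ℂ)
    (BoundedContinuousFunction E (E [×i.1.2]→L[ℝ] ℂ)) (schwartz_withSeminorms ℂ E ℂ) _
    ⟨{i.1}, 1, fun f => ?_⟩
  simpa using! (norm_weightedDeriv i.1.1 i.1.2 f).le

/-- The weighted derivatives of the translates of a Schwartz function grow at most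
polynomially. -/
theorem exists_norm_weightedDerivPi_compSubConstCLM_le (s : Finset (ℕ × ℕ)) (b : 𝓢(E, ℂ)) :
    ∃ (C : ℝ) (N : ℕ), 0 ≤ C ∧ ∀ y : E,
      ‖weightedDerivPi s (compSubConstCLM ℂ y b)‖ ≤ C * (1 + ‖y‖) ^ N := by
  choose C hC0 hC using fun i : s => exists_seminorm_compSubConstCLM_le b i.1.1 i.1.2
  refine ⟨∑ i : s, C i, ∑ i : s, i.1.1, Finset.sum_nonneg fun i _ => hC0 i, fun y => ?_⟩
  refine (norm_weightedDerivPi_le_sum s _).trans ?_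
  rw [Finset.sum_mul]
  refine Finset.sum_le_sum fun i _ => (hC i y).trans ?_
  refine mul_le_mul_of_nonneg_left (pow_le_pow_right₀ (by simp) ?_) (hC0 i)
  exact Finset.single_le_sum (f := fun i : s => i.1.1) (fun i _ => Nat.zero_le _)
    (Finset.mem_univ i)

/-- A tempered distribution factors through a Banach space of weighted derivatives. -/
theorem exists_apply_eq_weightedDerivPi (f : 𝓢'(E, ℂ)) :
    ∃ (s : Finset (ℕ × ℕ)) (g : WeightedJet E s →L[ℂ] ℂ),
      ∀ η : 𝓢(E, ℂ), f η = g (weightedDerivPi s η) := by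
  let f' : 𝓢(E, ℂ) →ₗ[ℂ] ℂ :=
    { toFun := f, map_add' := map_add f, map_smul' := map_smul f }
  have hf : Continuous f := map_continuous f
  obtain ⟨s, C, -, hC⟩ := Seminorm.bound_of_continuous (schwartz_withSeminorms ℂ E ℂ)
    ((normSeminorm ℂ ℂ).comp f') (continuous_norm.comp hf)
  have hbound : ∀ η : 𝓢(E, ℂ), ‖f' η‖ ≤ C * ‖weightedDerivPi s η‖ := fun η =>
    (hC η).trans (mul_le_mul_of_nonneg_left (sup_seminorm_le_norm_weightedDerivPi s η) C.2)
  exact ⟨s, f'.exists_continuousLinearMap_comp_eq (weightedDerivPi s) C hbound⟩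

end WeightedDeriv

/-! ### Tempered distributions applied to convolutions. -/

section Convolution

variable {E : Type*} [NormedAddCommGroup E] [InnerProductSpace ℝ E] [FiniteDimensional ℝ E]
  [MeasurableSpace E] [BorelSpace E]

/-- On the Fourier side convolution is a product and `∂_{v}` is multiplication by a linear factor,
so both sides have the same transform. -/
theorem lineDerivOp_convolution (a b : 𝓢(E, ℂ)) (v : E) :
    ∂_{v} (convolution (ContinuousLinearMap.mul ℂ ℂ) a b)
      = convolution (ContinuousLinearMap.mul ℂ ℂ) a (∂_{v} b) := by
  have h : 𝓕 (∂_{v} (convolution (ContinuousLinearMap.mul ℂ ℂ) a b))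
      = 𝓕 (convolution (ContinuousLinearMap.mul ℂ ℂ) a (∂_{v} b)) := by
    have hv : (inner ℝ · v).HasTemperateGrowth := ((innerSL ℝ).flip v).hasTemperateGrowth
    ext ξ
    rw [fourier_lineDerivOp_eq, fourier_convolution, fourier_convolution, fourier_lineDerivOp_eq]
    simp [smulLeftCLM_apply_apply hv]
    ring
  simpa using congrArg (fun g : 𝓢(E, ℂ) => 𝓕⁻ g) h

theorem iteratedLineDerivOp_convolution (a b : 𝓢(E, ℂ)) {n : ℕ} (v : Fin n → E) :
    ∂^{v} (convolution (ContinuousLinearMap.mul ℂ ℂ) a b)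
      = convolution (ContinuousLinearMap.mul ℂ ℂ) a (∂^{v} b) := by
  induction n with
  | zero => simp
  | succ n ih => rw [iteratedLineDerivOp_succ_left, ih, lineDerivOp_convolution,
      ← iteratedLineDerivOp_succ_left]

theorem convolution_mul_apply (a b : 𝓢(E, ℂ)) (x : E) :
    convolution (ContinuousLinearMap.mul ℂ ℂ) a b x = ∫ y, a y * b (x - y) := by
  rw [convolution_apply]
  rfl

theorem integrable_one_add_norm_pow_mul (a : 𝓢(E, ℂ)) (N : ℕ) :
    Integrable fun y : E => (1 + ‖y‖) ^ N * ‖a y‖ := by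
  have h : Integrable fun y : E => 2 ^ N * (‖a y‖ + ‖y‖ ^ N * ‖a y‖) :=
    (a.integrable.norm.add (a.integrable_pow_mul volume N)).const_mul _
  refine h.mono' (by fun_prop) (Filter.Eventually.of_forall fun y => ?_)
  rw [Real.norm_of_nonneg (by positivity)]
  have h2 : (1 + ‖y‖) ^ N ≤ 2 ^ N * (1 + ‖y‖ ^ N) := by
    have := add_pow_le (zero_le_one' ℝ) (norm_nonneg y) N
    rw [one_pow] at this
    refine this.trans ?_
    gcongr
    · exact one_le_two
    · exact Nat.sub_le N 1
  calc (1 + ‖y‖) ^ N * ‖a y‖ ≤ (2 ^ N * (1 + ‖y‖ ^ N)) * ‖a y‖ := by gcongr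
    _ = _ := by ring

/-- A tempered distribution commutes with the integral defining a convolution. -/
theorem apply_convolution_eq_integral (f : 𝓢'(E, ℂ)) (a b : 𝓢(E, ℂ)) :
    f (convolution (ContinuousLinearMap.mul ℂ ℂ) a b)
      = ∫ y, a y * f (compSubConstCLM ℂ y b) := by
  obtain ⟨s, g, hg⟩ := exists_apply_eq_weightedDerivPi f
  obtain ⟨C, N, hC, hbound⟩ := exists_norm_weightedDerivPi_compSubConstCLM_le s b
  set Γ := fun y => a y • weightedDerivPi s (compSubConstCLM ℂ y b) with hΓ
  have hcont : Continuous Γ :=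
    a.continuous.smul ((continuous_weightedDerivPi s).comp (continuous_compSubConstCLM b))
  have hint : Integrable Γ := by
    refine ((integrable_one_add_norm_pow_mul a N).const_mul C).mono' hcont.aestronglyMeasurable
      (Filter.Eventually.of_forall fun y => ?_)
    rw [hΓ, norm_smul]
    calc ‖a y‖ * ‖weightedDerivPi s (compSubConstCLM ℂ y b)‖
        ≤ ‖a y‖ * (C * (1 + ‖y‖) ^ N) := by gcongr; exact hbound y
      _ = _ := by ring
  -- Evaluations at points and vectors separate jets and commute with the Bochner integral, which
  -- reduces the claim to a scalar identity for derivatives of a convolution.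
  have key : ∫ y, Γ y = weightedDerivPi s (convolution (ContinuousLinearMap.mul ℂ ℂ) a b) := by
    refine WeightedJet.ext_apply fun i x v => ?_
    have h1 : (∫ y, Γ y) i x v = ∫ y, WeightedJet.eval i x v (Γ y) :=
      ((WeightedJet.eval i x v).integral_comp_comm hint).symm
    rw [h1, weightedDerivPi_apply, weightedDeriv_apply, smul_apply,
      ← iteratedLineDerivOp_eq_iteratedFDeriv, iteratedLineDerivOp_convolution,
      convolution_mul_apply, ← integral_smul]
    refine integral_congr_ae (Filter.Eventually.of_forall fun y => ?_)
    change a y • (‖x‖ ^ i.1.1 • iteratedFDeriv ℝ i.1.2 (compSubConstCLM ℂ y b) x v) = _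
    rw [iteratedFDeriv_compSubConstCLM, ← iteratedLineDerivOp_eq_iteratedFDeriv, smul_comm]
    rfl
  rw [hg, ← key, ← g.integral_comp_comm hint]
  refine integral_congr_ae (Filter.Eventually.of_forall fun y => ?_)
  change g (Γ y) = a y * f (compSubConstCLM ℂ y b)
  rw [hg, hΓ, map_smul, smul_eq_mul]

end Convolution

end SchwartzMap

end

noncomputable section

namespace BesovTL

open SchwartzMap

/-! ### Regularity of `g * f` and the reproducing formula. -/

section Conv

variable {d : ℕ}

/-- The reflection `y ↦ g (-y)` of a Schwartz function. -/
abbrev reflection (g : 𝓢(Rd d, ℂ)) : 𝓢(Rd d, ℂ) :=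
  SchwartzMap.compCLMOfContinuousLinearEquiv ℂ (ContinuousLinearEquiv.neg ℝ) g

theorem conv_eq (g : 𝓢(Rd d, ℂ)) (f : 𝓢'(Rd d, ℂ)) (x : Rd d) :
    conv g f x = f (compSubConstCLM ℂ x (reflection g)) := rfl

theorem continuous_conv (g : 𝓢(Rd d, ℂ)) (f : 𝓢'(Rd d, ℂ)) : Continuous (conv g f) :=
  (map_continuous f).comp (continuous_compSubConstCLM (reflection g))

/-- Supplies the a priori growth that starts the Nikolskii argument for `p ≤ 1`; here `C` and `N`
depend on `f`. -/
theorem exists_norm_conv_le (g : 𝓢(Rd d, ℂ)) (f : 𝓢'(Rd d, ℂ)) :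
    ∃ (C : ℝ) (N : ℕ), 0 ≤ C ∧ ∀ y, ‖conv g f y‖ ≤ C * (1 + ‖y‖) ^ N := by
  obtain ⟨s, T, hT⟩ := exists_apply_eq_weightedDerivPi f
  obtain ⟨C, N, hC, h⟩ := exists_norm_weightedDerivPi_compSubConstCLM_le s (reflection g)
  refine ⟨‖T‖ * C, N, by positivity, fun y => ?_⟩
  rw [conv_eq, hT, mul_assoc]
  exact (T.le_opNorm _).trans (by gcongr; exact h y)

theorem convolution_eq_self_of_fourier {ψ g : 𝓢(Rd d, ℂ)}
    (h : ∀ ξ, (𝓕 ψ : 𝓢(Rd d, ℂ)) ξ * (𝓕 g : 𝓢(Rd d, ℂ)) ξ = (𝓕 g : 𝓢(Rd d, ℂ)) ξ) :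
    convolution (ContinuousLinearMap.mul ℂ ℂ) ψ g = g := by
  have h' : 𝓕 (convolution (ContinuousLinearMap.mul ℂ ℂ) ψ g) = 𝓕 g := by
    ext ξ
    rw [fourier_convolution]
    simpa using h ξ
  simpa using congrArg (fun u : 𝓢(Rd d, ℂ) => 𝓕⁻ u) h'

/-- If `𝓕 ψ = 1` on the support of `𝓕 g`, then `g * f = ψ * (g * f)`. -/
theorem conv_eq_integral {ψ g : 𝓢(Rd d, ℂ)}
    (h : ∀ ξ, (𝓕 ψ : 𝓢(Rd d, ℂ)) ξ * (𝓕 g : 𝓢(Rd d, ℂ)) ξ = (𝓕 g : 𝓢(Rd d, ℂ)) ξ)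
    (f : 𝓢'(Rd d, ℂ)) (x : Rd d) :
    conv g f x = ∫ y, ψ (x - y) * conv g f y := by
  have key : compSubConstCLM ℂ x (reflection g) = convolution (ContinuousLinearMap.mul ℂ ℂ)
      (compSubConstCLM ℂ x (reflection ψ)) (reflection g) := by
    ext t
    rw [conv_kernel_apply, convolution_mul_apply]
    simp_rw [conv_kernel_apply]
    conv_lhs => rw [← convolution_eq_self_of_fourier h, convolution_mul_apply,
      ← integral_sub_left_eq_self _ volume x]
    refine integral_congr_ae (Filter.Eventually.of_forall fun y => ?_)
    simp only [compCLMOfContinuousLinearEquiv_apply, Function.comp_apply,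
      ContinuousLinearEquiv.neg_apply]
    congr 2
    abel
  rw [conv_eq, key, apply_convolution_eq_integral]
  simp_rw [conv_kernel_apply]
  rfl

end Conv

/-! ### Dyadic dilates: Fourier transform, sup bound and `L¹` norm. -/

section Dilate

variable {d : ℕ}

theorem fourier_dyadicDilate (φ : 𝓢(Rd d, ℂ)) (k : ℤ) (ξ : Rd d) :
    (𝓕 (dyadicDilate φ k) : 𝓢(Rd d, ℂ)) ξ = (𝓕 φ : 𝓢(Rd d, ℂ)) (((2 : ℝ) ^ k)⁻¹ • ξ) := by
  have h2 : (2 : ℝ) ^ k ≠ 0 := by positivity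
  rw [fourier_coe, fourier_coe, Real.fourier_eq, Real.fourier_eq]
  have := Measure.integral_comp_smul (volume : Measure (Rd d))
    (fun v => Real.fourierChar (-inner ℝ v (((2 : ℝ) ^ k)⁻¹ • ξ)) • φ v) ((2 : ℝ) ^ k)
  rw [finrank_euclideanSpace_fin, abs_of_nonneg (by positivity), eq_inv_smul_iff₀ (by positivity),
    ← integral_smul] at this
  rw [← this]
  refine integral_congr_ae (Filter.Eventually.of_forall fun v => ?_)
  simp only [dyadicDilate_apply]
  rw [inner_smul_left, inner_smul_right, smul_comm, zpow_mul, zpow_natCast]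
  simp [h2]

theorem norm_dyadicDilate_le (ψ : 𝓢(Rd d, ℂ)) (k : ℕ) (x : Rd d) :
    ‖dyadicDilate ψ k x‖ ≤ 2 ^ (k * d) * SchwartzMap.seminorm ℝ 0 0 ψ := by
  rw [dyadicDilate_apply, norm_smul, Real.norm_of_nonneg (by positivity)]
  have : (2 : ℝ) ^ ((k : ℤ) * (d : ℤ)) = 2 ^ (k * d) := by exact_mod_cast zpow_natCast (2 : ℝ) _
  rw [this]
  gcongr
  exact norm_le_seminorm ℝ ψ _

theorem integral_norm_dyadicDilate (ψ : 𝓢(Rd d, ℂ)) (k : ℤ) :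
    ∫ x, ‖dyadicDilate ψ k x‖ = ∫ x, ‖ψ x‖ := by
  have := Measure.integral_comp_smul (volume : Measure (Rd d)) (fun v => ‖ψ v‖) ((2 : ℝ) ^ k)
  rw [finrank_euclideanSpace_fin, abs_of_nonneg (by positivity), eq_inv_smul_iff₀ (by positivity),
    ← integral_smul] at this
  rw [← this]
  refine integral_congr_ae (Filter.Eventually.of_forall fun v => ?_)
  simp only [dyadicDilate_apply]
  rw [norm_smul, Real.norm_of_nonneg (by positivity), zpow_mul, zpow_natCast, smul_eq_mul]

end Dilate

/-! ### Frequency supports of the Littlewood-Paley kernels. -/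

namespace LittlewoodPaley

variable {d : ℕ} (L : LittlewoodPaley d)

theorem fourier_φ_eq_zero {ξ : Rd d} (h : 2 < ‖ξ‖) : (𝓕 L.φ : 𝓢(Rd d, ℂ)) ξ = 0 := by
  by_contra hne
  exact absurd (L.tsupport_fourier_φ (subset_tsupport _ hne)).2 (not_le.2 h)

theorem fourier_dyadicDilate_φ_eq_zero {k : ℤ} {ξ : Rd d} (h : 2 * (2 : ℝ) ^ k < ‖ξ‖) :
    (𝓕 (dyadicDilate L.φ k) : 𝓢(Rd d, ℂ)) ξ = 0 := by
  rw [fourier_dyadicDilate]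
  apply L.fourier_φ_eq_zero
  rw [norm_smul, norm_inv, Real.norm_of_nonneg (by positivity), ← div_eq_inv_mul,
    lt_div_iff₀ (by positivity)]
  exact h

/-- For `‖ξ‖ > 2` the terms with `k ≤ 0` of the partition of unity vanish, so those with `k ≥ 1`
already sum to 1. -/
theorem fourier_Φ_eq_zero {ξ : Rd d} (h : 2 < ‖ξ‖) : (𝓕 L.Φ : 𝓢(Rd d, ℂ)) ξ = 0 := by
  have hξ : ξ ≠ 0 := norm_pos_iff.1 (two_pos.trans h)
  have hinj : Function.Injective fun k : ℕ => (k : ℤ) + 1 := fun a b hab => by simpa using hab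
  have hz : ∀ k ∉ range (fun k : ℕ => (k : ℤ) + 1),
      (𝓕 (dyadicDilate L.φ k) : 𝓢(Rd d, ℂ)) ξ = 0 := by
    intro k hk
    have hk0 : k ≤ 0 := by
      by_contra! hpos
      exact hk ⟨(k - 1).toNat, by simp; omega⟩
    apply L.fourier_dyadicDilate_φ_eq_zero
    have : (2 : ℝ) ^ k ≤ 1 := zpow_le_one_of_nonpos₀ one_le_two hk0
    linarith
  have hs := (hinj.hasSum_iff hz).2 (L.hasSum_fourier_φ ξ hξ)
  have ht : ∑' k : ℕ, (𝓕 (dyadicDilate L.φ ((k : ℤ) + 1)) : 𝓢(Rd d, ℂ)) ξ = 1 := hs.tsum_eq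
  rw [L.fourier_Φ, ht, sub_self]

/-- The kernel of the `k`-th Littlewood-Paley operator. -/
def kernel (k : ℕ) : 𝓢(Rd d, ℂ) := if k = 0 then L.Φ else dyadicDilate L.φ (k : ℤ)

theorem fourier_kernel_eq_zero {k : ℕ} {ξ : Rd d} (h : 2 * (2 : ℝ) ^ k < ‖ξ‖) :
    (𝓕 (L.kernel k) : 𝓢(Rd d, ℂ)) ξ = 0 := by
  unfold kernel
  split_ifs with hk
  · subst hk
    exact L.fourier_Φ_eq_zero (by simpa using h)
  · exact L.fourier_dyadicDilate_φ_eq_zero (by simpa using h)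

end LittlewoodPaley

variable {d : ℕ}

theorem exists_fourier_eq_one (d : ℕ) :
    ∃ ψ : 𝓢(Rd d, ℂ), ∀ ξ : Rd d, ‖ξ‖ ≤ 2 → (𝓕 ψ : 𝓢(Rd d, ℂ)) ξ = 1 := by
  let χ : ContDiffBump (0 : Rd d) := ⟨2, 3, by norm_num, by norm_num⟩
  have hsupp : HasCompactSupport fun x => (χ x : ℂ) :=
    χ.hasCompactSupport.comp_left Complex.ofReal_zero
  have hsmooth : ContDiff ℝ ((⊤ : ℕ∞) : WithTop ℕ∞) fun x => (χ x : ℂ) :=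
    Complex.ofRealCLM.contDiff.comp χ.contDiff
  refine ⟨𝓕⁻ (hsupp.toSchwartzMap hsmooth), fun ξ hξ => ?_⟩
  rw [FourierTransform.fourier_fourierInv_eq]
  simp [χ.one_of_mem_closedBall (by simpa using hξ : ξ ∈ Metric.closedBall 0 χ.rIn)]

/-- The Littlewood-Paley pieces reproduce under convolution with the dilates of a fixed Schwartz
function. -/
theorem exists_Lam_eq_integral (L : LittlewoodPaley d) :
    ∃ ψ : 𝓢(Rd d, ℂ), ∀ (k : ℕ) (f : 𝓢'(Rd d, ℂ)) (x : Rd d),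
      L.Lam k f x = ∫ y, dyadicDilate ψ k (x - y) * L.Lam k f y := by
  obtain ⟨ψ, hψ⟩ := exists_fourier_eq_one d
  refine ⟨ψ, fun k f x => conv_eq_integral (fun ξ => ?_) f x⟩
  rcases le_or_gt ‖ξ‖ (2 * (2 : ℝ) ^ k) with h | h
  · rw [fourier_dyadicDilate, hψ, one_mul]
    rw [norm_smul, norm_inv, Real.norm_of_nonneg (by positivity), zpow_natCast, ← div_eq_inv_mul,
      div_le_iff₀ (by positivity)]
    exact h
  · have := L.fourier_kernel_eq_zero h
    change _ * (𝓕 (L.kernel k) : 𝓢(Rd d, ℂ)) ξ = (𝓕 (L.kernel k) : 𝓢(Rd d, ℂ)) ξ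
    rw [this, mul_zero]

end BesovTL

end

noncomputable section

namespace BesovTL

open SchwartzMap

/-! ### Pointwise bounds by `L^p` quasi-norms for functions dominated by a kernel integral. -/

section Reproducing

variable {α : Type*} [MeasurableSpace α] {μ : Measure α}

/-- For `1 < p`, a function dominated at `z` by its integral against a bounded integrable kernel
is controlled there by its `L^p` norm. -/
theorem rpow_le_of_le_lintegral_kernel {G κ : α → ℝ≥0∞} {A c : ℝ≥0∞} {p : ℝ} (hp : 1 < p)
    (hGm : AEMeasurable G μ) (hκm : AEMeasurable κ μ) (hκ : ∀ y, κ y ≤ A) (hA : A ≠ ∞)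
    (hc : c ≤ ∫⁻ y, κ y * G y ∂μ) :
    c ^ p ≤ (∫⁻ y, κ y ∂μ) ^ (p - 1) * (A * ∫⁻ y, G y ^ p ∂μ) := by
  have hp0 : 0 < p := one_pos.trans hp
  have hpq : (p.conjExponent).HolderConjugate p := (Real.HolderConjugate.conjExponent hp).symm
  set q := p.conjExponent
  have hq0 : 0 < q := hpq.pos
  have hsum : 1 / q + 1 / p = 1 := by simpa using hpq.inv_add_inv_eq_one
  -- Hölder after splitting `κ = κ ^ (1/q) * κ ^ (1/p)`.
  have h1 : ∫⁻ y, κ y * G y ∂μ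
      ≤ (∫⁻ y, κ y ∂μ) ^ (1 / q) * (∫⁻ y, κ y * G y ^ p ∂μ) ^ (1 / p) := by
    have := ENNReal.lintegral_mul_le_Lp_mul_Lq μ hpq (hκm.pow_const (1 / q))
      ((hκm.pow_const (1 / p)).mul hGm)
    refine le_trans (lintegral_mono fun y => ?_) (this.trans_eq ?_)
    · simp only [Pi.mul_apply]
      rw [← mul_assoc, ← ENNReal.rpow_add_of_nonneg _ _ (by positivity) (by positivity), hsum,
        ENNReal.rpow_one]
    · congr 2
      · refine lintegral_congr fun y => ?_
        rw [← ENNReal.rpow_mul, one_div_mul_cancel hq0.ne', ENNReal.rpow_one]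
      · refine lintegral_congr fun y => ?_
        simp only [Pi.mul_apply]
        rw [ENNReal.mul_rpow_of_nonneg _ _ hp0.le, ← ENNReal.rpow_mul,
          one_div_mul_cancel hp0.ne', ENNReal.rpow_one]
  have h2 : ∫⁻ y, κ y * G y ^ p ∂μ ≤ A * ∫⁻ y, G y ^ p ∂μ := by
    rw [← lintegral_const_mul' _ _ hA]
    exact lintegral_mono fun y => mul_le_mul_left (hκ y) _
  have hqp : 1 / q * p = p - 1 := by
    have : 1 / q = 1 - 1 / p := by linarith
    rw [this]
    field_simp
  calc c ^ p ≤ ((∫⁻ y, κ y ∂μ) ^ (1 / q) * (∫⁻ y, κ y * G y ^ p ∂μ) ^ (1 / p)) ^ p :=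
        ENNReal.rpow_le_rpow (hc.trans h1) hp0.le
    _ = (∫⁻ y, κ y ∂μ) ^ (p - 1) * ∫⁻ y, κ y * G y ^ p ∂μ := by
        rw [ENNReal.mul_rpow_of_nonneg _ _ hp0.le, ← ENNReal.rpow_mul, ← ENNReal.rpow_mul,
          one_div_mul_cancel hp0.ne', ENNReal.rpow_one, hqp]
    _ ≤ _ := by gcongr

/-- For `p ≤ 1`, a function of at most the size of a weight `W` and dominated by its integral
against a kernel compatible with `W` is controlled by its `L^p` quasi-norm. -/
theorem rpow_le_of_le_lintegral_kernel_of_le_one {G W : α → ℝ≥0∞} {κ : α → α → ℝ≥0∞}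
    {A S₀ : ℝ≥0∞} {p : ℝ} (hp0 : 0 < p) (hp1 : p ≤ 1)
    (hW1 : ∀ y, 1 ≤ W y) (hW : ∀ y, W y ≠ ∞) (hA : A ≠ ∞) (hS₀ : S₀ ≠ ∞)
    (hGW : ∀ y, G y ≤ S₀ * W y) (hG : ∀ z, G z ≤ ∫⁻ y, κ z y * G y ∂μ)
    (hκ : ∀ z y, κ z y * W y ≤ A * W z) (z : α) :
    G z ^ p ≤ A * (∫⁻ y, G y ^ p ∂μ) * W z ^ p := by
  have hW0 : ∀ y, W y ≠ 0 := fun y => (one_pos.trans_le (hW1 y)).ne'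
  set S := ⨆ y, G y / W y with hSdef
  have hS : S ≠ ∞ := ne_top_of_le_ne_top hS₀ <| iSup_le fun y =>
    ENNReal.div_le_of_le_mul (hGW y)
  have hGS : ∀ y, G y ≤ S * W y := fun y =>
    (ENNReal.div_le_iff (hW0 y) (hW y)).1 (le_iSup (fun y => G y / W y) y)
  have hS1 : S ^ (1 - p) ≠ ∞ := ENNReal.rpow_ne_top_of_nonneg (by linarith) hS
  -- Trade `G ^ (1 - p)` for the weighted supremum; `W ^ (1 - p) ≤ W` because `W ≥ 1`.
  have hpt : ∀ y, G y ≤ S ^ (1 - p) * (W y * G y ^ p) := fun y => by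
    calc G y = G y ^ (1 - p) * G y ^ p := by
          rw [← ENNReal.rpow_add_of_nonneg _ _ (by linarith) hp0.le, sub_add_cancel,
            ENNReal.rpow_one]
      _ ≤ (S * W y) ^ (1 - p) * G y ^ p := by
          refine mul_le_mul_left (ENNReal.rpow_le_rpow (hGS y) (by linarith)) _
      _ = S ^ (1 - p) * (W y ^ (1 - p) * G y ^ p) := by
          rw [ENNReal.mul_rpow_of_nonneg _ _ (by linarith), mul_assoc]
      _ ≤ S ^ (1 - p) * (W y * G y ^ p) := by
          gcongr
          conv_rhs => rw [← ENNReal.rpow_one (W y)]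
          exact ENNReal.rpow_le_rpow_of_exponent_le (hW1 y) (by linarith)
  set I := ∫⁻ y, G y ^ p ∂μ
  have hmain : ∀ z, G z ≤ S ^ (1 - p) * (A * I) * W z := fun z => by
    calc G z ≤ ∫⁻ y, κ z y * G y ∂μ := hG z
      _ ≤ ∫⁻ y, (S ^ (1 - p) * (A * W z)) * G y ^ p ∂μ := by
          refine lintegral_mono fun y => ?_
          calc κ z y * G y ≤ κ z y * (S ^ (1 - p) * (W y * G y ^ p)) := by gcongr; exact hpt y
            _ = S ^ (1 - p) * (κ z y * W y) * G y ^ p := by ring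
            _ ≤ _ := mul_le_mul_left (mul_le_mul_right (hκ z y) _) _
      _ = S ^ (1 - p) * (A * W z) * I :=
          lintegral_const_mul' _ _ (ENNReal.mul_ne_top hS1 (ENNReal.mul_ne_top hA (hW z)))
      _ = _ := by ring
  -- Absorption: dividing by `S ^ (1 - p)` is legitimate only because `S` is known to be finite.
  have hSle : S ≤ S ^ (1 - p) * (A * I) := iSup_le fun y =>
    ENNReal.div_le_of_le_mul (hmain y)
  have hSp : S ^ p ≤ A * I := by
    rcases eq_or_ne S 0 with h0 | h0
    · rw [h0, ENNReal.zero_rpow_of_pos hp0]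
      exact zero_le
    · have h1 : S ^ (1 - p) ≠ 0 := by
        rw [Ne, ENNReal.rpow_eq_zero_iff]
        simp [h0, hS]
      rw [← ENNReal.mul_le_mul_iff_right h1 hS1, ← ENNReal.rpow_add _ _ h0 hS, sub_add_cancel,
        ENNReal.rpow_one]
      exact hSle
  calc G z ^ p ≤ (S * W z) ^ p := ENNReal.rpow_le_rpow (hGS z) hp0.le
    _ = S ^ p * W z ^ p := ENNReal.mul_rpow_of_nonneg _ _ hp0.le
    _ ≤ _ := by gcongr

end Reproducing

/-! ### The Plancherel-Polya-Nikolskii inequality. -/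

section Nikolskii

variable {d : ℕ}

theorem exists_norm_mul_one_add_pow_le (ψ : 𝓢(Rd d, ℂ)) (N : ℕ) :
    ∃ A : ℝ, 0 ≤ A ∧ ∀ u, ‖ψ u‖ * (1 + ‖u‖) ^ N ≤ A := by
  refine ⟨2 ^ N * (Finset.Iic (N, 0)).sup (fun m => SchwartzMap.seminorm ℝ m.1 m.2) ψ,
    by positivity, fun u => ?_⟩
  have := one_add_le_sup_seminorm_apply (𝕜 := ℝ) (m := (N, 0)) le_rfl le_rfl ψ u
  rwa [norm_iteratedFDeriv_zero, mul_comm] at this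

/-- The boundedness of a function of polynomial growth and in `L^p`, `p ≤ 1`, which reproduces
under convolution with a Schwartz function. -/
theorem exists_enorm_le_of_le_one {ψ : 𝓢(Rd d, ℂ)} {g : Rd d → ℂ} {p C : ℝ} {N : ℕ}
    (hp0 : 0 < p) (hp1 : p ≤ 1) (hC : 0 ≤ C) (hg : ∀ y, ‖g y‖ ≤ C * (1 + ‖y‖) ^ N)
    (hrep : ∀ x, ‖g x‖ₑ ≤ ∫⁻ y, ‖ψ (x - y)‖ₑ * ‖g y‖ₑ)
    (hI : ∫⁻ y, ‖g y‖ₑ ^ p ≠ ∞) : ∃ S : ℝ≥0∞, S ≠ ∞ ∧ ∀ x, ‖g x‖ₑ ≤ S := by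
  obtain ⟨A, hA0, hA⟩ := exists_norm_mul_one_add_pow_le ψ N
  refine ⟨(ENNReal.ofReal A * ∫⁻ y, ‖g y‖ₑ ^ p) ^ (1 / p),
    ENNReal.rpow_ne_top_of_nonneg (by positivity) (ENNReal.mul_ne_top ENNReal.ofReal_ne_top hI),
    fun x => ?_⟩
  have htri : ∀ a b : Rd d, (1 + ‖a + b‖) ^ N ≤ (1 + ‖a‖) ^ N * (1 + ‖b‖) ^ N := fun a b => by
    rw [← mul_pow]
    gcongr
    nlinarith [norm_add_le a b, norm_nonneg a, norm_nonneg b]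
  -- The weight is centred at the point `x` of interest, so it equals 1 there and the resulting
  -- bound does not depend on `x`.
  have key := rpow_le_of_le_lintegral_kernel_of_le_one (μ := volume) (G := fun y => ‖g y‖ₑ)
    (W := fun y => ENNReal.ofReal ((1 + ‖x - y‖) ^ N)) (κ := fun z y => ‖ψ (z - y)‖ₑ)
    (A := ENNReal.ofReal A) (S₀ := ENNReal.ofReal (C * (1 + ‖x‖) ^ N)) hp0 hp1
    (fun y => ENNReal.one_le_ofReal.2 (one_le_pow₀ (by simp)))
    (fun y => ENNReal.ofReal_ne_top) ENNReal.ofReal_ne_top ENNReal.ofReal_ne_top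
    (fun y => ?_) hrep (fun z y => ?_) x
  · have : ENNReal.ofReal ((1 + ‖x - x‖) ^ N) = 1 := by simp
    rw [this, ENNReal.one_rpow, mul_one] at key
    rwa [one_div, ENNReal.le_rpow_inv_iff hp0]
  · rw [← ofReal_norm, ← ENNReal.ofReal_mul (by positivity)]
    refine ENNReal.ofReal_le_ofReal ((hg y).trans ?_)
    have := htri x (y - x)
    rw [add_sub_cancel, norm_sub_rev y x] at this
    rw [mul_assoc]
    gcongr
  · rw [← ofReal_norm, ← ENNReal.ofReal_mul (by positivity), ← ENNReal.ofReal_mul (by positivity)]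
    refine ENNReal.ofReal_le_ofReal ?_
    have := htri (z - y) (x - z)
    rw [show z - y + (x - z) = x - y by abel] at this
    calc ‖ψ (z - y)‖ * (1 + ‖x - y‖) ^ N
        ≤ ‖ψ (z - y)‖ * ((1 + ‖z - y‖) ^ N * (1 + ‖x - z‖) ^ N) := by gcongr
      _ = (‖ψ (z - y)‖ * (1 + ‖z - y‖) ^ N) * (1 + ‖x - z‖) ^ N := by ring
      _ ≤ _ := by gcongr; exact hA _

/-- The inequality of Plancherel-Polya-Nikolskii for the Littlewood-Paley pieces. -/
theorem exists_enorm_Lam_rpow_le (L : LittlewoodPaley d) {p : ℝ} (hp : 0 < p) :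
    ∃ C : ℝ≥0, ∀ (k : ℕ) (f : 𝓢'(Rd d, ℂ)), ∫⁻ y, ‖L.Lam k f y‖ₑ ^ p ≠ ∞ →
      ∀ x, ‖L.Lam k f x‖ₑ ^ p ≤ C * 2 ^ (k * d) * ∫⁻ y, ‖L.Lam k f y‖ₑ ^ p := by
  obtain ⟨ψ, hψ⟩ := exists_Lam_eq_integral L
  set M := SchwartzMap.seminorm ℝ 0 0 ψ
  have hM0 : 0 ≤ M := apply_nonneg _ _
  have hA : ∀ (k : ℕ) (u : Rd d), ‖dyadicDilate ψ k u‖ₑ ≤ ENNReal.ofReal M * 2 ^ (k * d) := by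
    intro k u
    rw [← ofReal_norm]
    refine (ENNReal.ofReal_le_ofReal (norm_dyadicDilate_le ψ k u)).trans_eq ?_
    rw [ENNReal.ofReal_mul (by positivity), ENNReal.ofReal_pow (by norm_num), ENNReal.ofReal_ofNat,
      mul_comm]
  have hAtop : ∀ k : ℕ, ENNReal.ofReal M * 2 ^ (k * d) ≠ ∞ := fun k =>
    ENNReal.mul_ne_top ENNReal.ofReal_ne_top (ENNReal.pow_ne_top (by norm_num))
  have hrep : ∀ (k : ℕ) f x,
      ‖L.Lam k f x‖ₑ ≤ ∫⁻ y, ‖dyadicDilate ψ k (x - y)‖ₑ * ‖L.Lam k f y‖ₑ := by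
    intro k f x
    conv_lhs => rw [hψ]
    refine (enorm_integral_le_lintegral_enorm _).trans_eq ?_
    simp_rw [enorm_mul]
  rcases le_or_gt p 1 with hp1 | hp1
  · refine ⟨M.toNNReal, fun k f hI x => ?_⟩
    obtain ⟨C, N, hC, hg⟩ := exists_norm_conv_le (L.kernel k) f
    obtain ⟨S, hS, hgS⟩ := exists_enorm_le_of_le_one hp hp1 hC hg (hrep k f) hI
    -- The bound `S` just obtained depends on `f` through `N`. Once boundedness is known, a second
    -- pass with the trivial weight uses only the supremum of the kernel and gives a uniform
    -- constant.
    have := rpow_le_of_le_lintegral_kernel_of_le_one (μ := volume) (G := fun y => ‖L.Lam k f y‖ₑ)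
      (W := fun _ => 1) (κ := fun z y => ‖dyadicDilate ψ k (z - y)‖ₑ)
      (A := ENNReal.ofReal M * 2 ^ (k * d)) hp hp1 (fun _ => le_rfl) (fun _ => ENNReal.one_ne_top)
      (hAtop k) hS (fun y => (hgS y).trans_eq (mul_one S).symm) (hrep k f)
      (fun z y => by simpa using hA k (z - y)) x
    rwa [ENNReal.one_rpow, mul_one] at this
  -- The `L¹` norm of the dilates is independent of `k`; the factor `2 ^ (k d)` comes from their
  -- supremum alone.
  · refine ⟨((∫ y, ‖ψ y‖) ^ (p - 1) * M).toNNReal, fun k f _ x => ?_⟩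
    have hnn : 0 ≤ ∫ y, ‖ψ y‖ := by positivity
    have hL1 : ∫⁻ y, ‖dyadicDilate ψ k (x - y)‖ₑ = ENNReal.ofReal (∫ y, ‖ψ y‖) := by
      rw [lintegral_sub_left_eq_self (fun y => ‖dyadicDilate ψ k y‖ₑ) x,
        ← integral_norm_dyadicDilate ψ k,
        ofReal_integral_norm_eq_lintegral_enorm (dyadicDilate ψ k).integrable]
    have := rpow_le_of_le_lintegral_kernel (μ := volume) (G := fun y => ‖L.Lam k f y‖ₑ)
      (κ := fun y => ‖dyadicDilate ψ k (x - y)‖ₑ) hp1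
      (continuous_conv (L.kernel k) f).enorm.measurable.aemeasurable
      (((dyadicDilate ψ k).continuous.comp (continuous_sub_left x)).enorm.measurable.aemeasurable)
      (fun y => hA k (x - y)) (hAtop k) (hrep k f x)
    refine this.trans_eq ?_
    rw [hL1, ENNReal.ofReal_rpow_of_nonneg hnn (by linarith)]
    change _ = ENNReal.ofReal _ * _ * _
    rw [ENNReal.ofReal_mul (by positivity)]
    ring

end Nikolskii

end BesovTL

end

noncomputable section

namespace BesovTL

/-! ### Averages of `H ^ q` from `L^p` and pointwise bounds. -/

section Average

variable {α : Type*} [MeasurableSpace α] {μ : Measure α}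

/-- Averages of `H ^ q` over a set, from a pointwise bound of `H` and a bound of its `L^p`
quasi-norm. -/
theorem exists_average_rpow_le {p q : ℝ} (hp : 0 < p) (hq : 0 < q) (C : ℝ≥0) :
    ∃ (D : ℝ≥0) (r : ℝ), 0 < r ∧ ∀ {ε B : ℝ≥0∞} {H : α → ℝ≥0∞} {P : Set α},
      B ≠ ∞ → μ P ≠ 0 → μ P ≠ ∞ → AEMeasurable H μ → (∀ x, H x ^ p ≤ C * B ^ p) →
      ∫⁻ x, H x ^ p ∂μ ≤ ε * μ P * B ^ p →
      (μ P)⁻¹ * ∫⁻ x in P, H x ^ q ∂μ ≤ D * ε ^ r * B ^ q := by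
  rcases le_or_gt p q with hpq | hpq
  -- For `p ≤ q`, bound `H ^ (q - p)` by its supremum; the gain `ε` survives to the first power.
  · have hqp : 0 ≤ q / p - 1 := by
      rw [sub_nonneg, le_div_iff₀ hp]
      linarith
    refine ⟨C ^ (q / p - 1), 1, one_pos, fun {ε B H P} hB hV0 hV hHm hsup hint => ?_⟩
    set M := ((C : ℝ≥0∞) * B ^ p) ^ (q / p - 1) with hM
    have hMtop : M ≠ ∞ := ENNReal.rpow_ne_top_of_nonneg hqp
      (ENNReal.mul_ne_top ENNReal.coe_ne_top (ENNReal.rpow_ne_top_of_nonneg hp.le hB))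
    have hpt : ∀ x, H x ^ q ≤ M * H x ^ p := fun x => by
      calc H x ^ q = (H x ^ p) ^ (q / p - 1) * (H x ^ p) ^ (1 : ℝ) := by
            rw [← ENNReal.rpow_add_of_nonneg _ _ hqp zero_le_one, sub_add_cancel,
              ← ENNReal.rpow_mul, mul_div_cancel₀ _ hp.ne']
        _ ≤ M * H x ^ p := by
            rw [ENNReal.rpow_one]
            exact mul_le_mul_left (ENNReal.rpow_le_rpow (hsup x) hqp) _
    have hMB : M * B ^ p = (C : ℝ≥0∞) ^ (q / p - 1) * B ^ q := by
      rw [hM, ENNReal.mul_rpow_of_nonneg _ _ hqp, mul_assoc, ← ENNReal.rpow_mul,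
        ← ENNReal.rpow_add_of_nonneg _ _ (by positivity) hp.le]
      congr 2
      field_simp
      ring
    calc (μ P)⁻¹ * ∫⁻ x in P, H x ^ q ∂μ
        ≤ (μ P)⁻¹ * ∫⁻ x, M * H x ^ p ∂μ := by
          exact mul_le_mul_right ((lintegral_mono hpt).trans (setLIntegral_le_lintegral _ _)) _
      _ ≤ (μ P)⁻¹ * (M * (ε * μ P * B ^ p)) := by
          rw [lintegral_const_mul' _ _ hMtop]
          gcongr
      _ = ((μ P)⁻¹ * μ P) * (ε * (M * B ^ p)) := by ring
      _ = _ := by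
          rw [ENNReal.inv_mul_cancel hV0 hV, one_mul, hMB, ENNReal.rpow_one,
            ENNReal.coe_rpow_of_nonneg _ hqp]
          ring
  -- For `q < p`, Hölder on `P` with exponent `p / q`; the gain becomes `ε ^ (q / p)` and the
  -- pointwise bound plays no role.
  · have hr : 0 < q / p := by positivity
    have hr1 : q / p < 1 := (div_lt_one hp).2 hpq
    refine ⟨1, q / p, hr, fun {ε B H P} hB hV0 hV hHm hsup hint => ?_⟩
    have hconj : (p / q).HolderConjugate (p / q).conjExponent :=
      Real.HolderConjugate.conjExponent ((one_lt_div hq).2 hpq)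
    have h2 : 1 / (p / q).conjExponent = 1 - q / p := by
      have := hconj.inv_add_inv_eq_one
      rw [inv_div] at this
      rw [one_div]
      linarith
    have hH := ENNReal.lintegral_mul_le_Lp_mul_Lq (μ.restrict P) hconj
      ((hHm.mono_measure Measure.restrict_le_self).pow_const q)
      (aemeasurable_const (b := (1 : ℝ≥0∞)))
    simp only [Pi.mul_apply, mul_one, ENNReal.one_rpow, lintegral_const, one_mul,
      Measure.restrict_apply_univ, h2, one_div_div] at hH
    have hexp : ∀ x, (H x ^ q) ^ (p / q) = H x ^ p := fun x => by
      rw [← ENNReal.rpow_mul, mul_div_cancel₀ _ hq.ne']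
    simp only [hexp] at hH
    calc (μ P)⁻¹ * ∫⁻ x in P, H x ^ q ∂μ
        ≤ (μ P)⁻¹ * ((ε * μ P * B ^ p) ^ (q / p) * μ P ^ (1 - q / p)) := by
          refine mul_le_mul_right (hH.trans (mul_le_mul_left ?_ _)) _
          exact ENNReal.rpow_le_rpow ((setLIntegral_le_lintegral _ _).trans hint) hr.le
      _ = (μ P)⁻¹ * (μ P ^ (q / p) * μ P ^ (1 - q / p)) * (ε ^ (q / p) * B ^ q) := by
          rw [ENNReal.mul_rpow_of_nonneg _ _ hr.le, ENNReal.mul_rpow_of_nonneg _ _ hr.le,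
            ← ENNReal.rpow_mul, mul_div_cancel₀ _ hp.ne']
          ring
      _ = _ := by
          rw [← ENNReal.rpow_add_of_nonneg _ _ hr.le (by linarith), add_sub_cancel,
            ENNReal.rpow_one, ENNReal.inv_mul_cancel hV0 hV, one_mul, ENNReal.coe_one, one_mul]

end Average

/-! ### The embedding. -/

variable {d : ℕ}

theorem volume_dyadicCube (m : ℕ) (n : Fin d → ℤ) :
    volume (dyadicCube (m : ℤ) n) = (((2 : ℝ≥0∞) ^ d)⁻¹) ^ m := by
  have hpre : dyadicCube (m : ℤ) n = (WithLp.ofLp : Rd d → Fin d → ℝ) ⁻¹'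
      (univ.pi fun i => Ico ((2 : ℝ) ^ (-(m : ℤ)) * (n i : ℝ))
        ((2 : ℝ) ^ (-(m : ℤ)) * ((n i : ℝ) + 1))) := by
    ext x
    simp [dyadicCube, Set.mem_pi]
  rw [hpre, (PiLp.volume_preserving_ofLp (Fin d)).measure_preimage
    (MeasurableSet.univ_pi fun i => measurableSet_Ico).nullMeasurableSet, volume_pi_pi]
  have hside : ∀ i, (2 : ℝ) ^ (-(m : ℤ)) * ((n i : ℝ) + 1) - (2 : ℝ) ^ (-(m : ℤ)) * (n i : ℝ)
      = ((2 : ℝ) ^ m)⁻¹ := fun i => by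
    rw [zpow_neg, zpow_natCast]
    ring
  simp_rw [Real.volume_Ico, hside]
  rw [Finset.prod_const, Finset.card_univ, Fintype.card_fin, ENNReal.ofReal_inv_of_pos (by positivity),
    ENNReal.ofReal_pow (by norm_num), ENNReal.ofReal_ofNat, ENNReal.inv_pow, ENNReal.inv_pow,
    ← pow_mul, ← pow_mul, mul_comm]

theorem ofReal_two_rpow (t : ℝ) : ENNReal.ofReal ((2 : ℝ) ^ t) = (2 : ℝ≥0∞) ^ t := by
  rw [← ENNReal.ofReal_rpow_of_pos two_pos, ENNReal.ofReal_ofNat]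

theorem lintegral_rpow_le_besovNorm (L : LittlewoodPaley d) {p : ℝ} (hp : 0 < p) (s : ℝ) (k : ℕ)
    (f : 𝓢'(Rd d, ℂ)) :
    ∫⁻ x, ((2 : ℝ≥0∞) ^ (s * k) * ‖L.Lam k f x‖ₑ) ^ p
      ≤ besovNorm L (ENNReal.ofReal p) s ∞ f ^ p := by
  have h1 : eLpNorm (fun x => (((2 : ℝ) ^ (s * k) : ℝ) : ℂ) * L.Lam k f x) (ENNReal.ofReal p) volume
      ≤ besovNorm L (ENNReal.ofReal p) s ∞ f := by
    rw [besovNorm, seqNorm, if_pos rfl]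
    exact le_iSup (fun k : ℕ => eLpNorm (fun x => (((2 : ℝ) ^ (s * k) : ℝ) : ℂ) * L.Lam k f x)
      (ENNReal.ofReal p) volume) k
  rw [eLpNorm_eq_lintegral_rpow_enorm_toReal (by simpa using hp) ENNReal.ofReal_ne_top,
    ENNReal.toReal_ofReal hp.le, one_div, ENNReal.rpow_inv_le_iff hp] at h1
  refine le_trans (lintegral_mono fun x => ?_) h1
  rw [enorm_mul, ← ofReal_norm (((2 : ℝ) ^ (s * k) : ℝ) : ℂ), Complex.norm_real,
    Real.norm_of_nonneg (by positivity), ofReal_two_rpow]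

/-- The rescaled Littlewood-Paley pieces of a Besov function are uniformly bounded, and decay
in `L^p`. -/
theorem exists_weighted_Lam_bounds (L : LittlewoodPaley d) {p : ℝ} (hp : 0 < p) (s₀ s : ℝ)
    (hs : s = s₀ - d / p) :
    ∃ C : ℝ≥0, ∀ f ∈ besovSpace L (ENNReal.ofReal p) s₀ ∞, ∀ k : ℕ,
      (∀ x, ((2 : ℝ≥0∞) ^ (s * k) * ‖L.Lam k f x‖ₑ) ^ p
        ≤ C * besovNorm L (ENNReal.ofReal p) s₀ ∞ f ^ p) ∧
      ∫⁻ x, ((2 : ℝ≥0∞) ^ (s * k) * ‖L.Lam k f x‖ₑ) ^ p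
        ≤ (((2 : ℝ≥0∞) ^ d)⁻¹) ^ k * besovNorm L (ENNReal.ofReal p) s₀ ∞ f ^ p := by
  obtain ⟨C, hC⟩ := exists_enorm_Lam_rpow_le L hp
  refine ⟨C, fun f hf k => ?_⟩
  set B := besovNorm L (ENNReal.ofReal p) s₀ ∞ f
  have hB : B ≠ ∞ := ne_of_lt hf
  set G := fun x => ‖L.Lam k f x‖ₑ
  have htop : ∀ t : ℝ, ((2 : ℝ≥0∞) ^ t) ≠ ∞ := fun t => by
    rw [← ofReal_two_rpow]
    exact ENNReal.ofReal_ne_top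
  have hpow : ∀ (t : ℝ) x, ((2 : ℝ≥0∞) ^ t * G x) ^ p = (2 : ℝ≥0∞) ^ (t * p) * G x ^ p :=
    fun t x => by rw [ENNReal.mul_rpow_of_nonneg _ _ hp.le, ← ENNReal.rpow_mul]
  have hadd : ∀ t u : ℝ, (2 : ℝ≥0∞) ^ (t + u) = 2 ^ t * 2 ^ u := fun t u =>
    ENNReal.rpow_add _ _ (by norm_num) (by norm_num)
  have hβ : (((2 : ℝ≥0∞) ^ d)⁻¹) ^ k = 2 ^ (-((k * d : ℕ) : ℝ)) := by
    rw [ENNReal.rpow_neg, ENNReal.rpow_natCast, ← ENNReal.inv_pow, ← pow_mul, mul_comm k]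
  have hint : ∫⁻ x, ((2 : ℝ≥0∞) ^ (s * k) * G x) ^ p ≤ (((2 : ℝ≥0∞) ^ d)⁻¹) ^ k * B ^ p := by
    have h0 := lintegral_rpow_le_besovNorm L hp s₀ k f
    have heq : s * k * p = -((k * d : ℕ) : ℝ) + s₀ * k * p := by
      rw [hs]
      push_cast
      field_simp
      ring
    have hpt : ∀ x, ((2 : ℝ≥0∞) ^ (s * k) * G x) ^ p
        = (((2 : ℝ≥0∞) ^ d)⁻¹) ^ k * ((2 : ℝ≥0∞) ^ (s₀ * k) * G x) ^ p := fun x => by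
      rw [hpow, hpow, heq, hadd, hβ, mul_assoc]
    simp_rw [hpt]
    rw [lintegral_const_mul' _ _ (by rw [hβ]; exact htop _)]
    exact mul_le_mul_right h0 _
  refine ⟨fun x => ?_, hint⟩
  have hfac : ∫⁻ x, ((2 : ℝ≥0∞) ^ (s * k) * G x) ^ p = 2 ^ (s * k * p) * ∫⁻ x, G x ^ p := by
    simp_rw [hpow]
    exact lintegral_const_mul' _ _ (htop _)
  rw [hfac] at hint
  -- The Nikolskii inequality requires a finite integral; it is finite because `B` is finite and the
  -- weight is nonzero.
  have hGint : ∫⁻ x, G x ^ p ≠ ∞ := by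
    intro h
    rw [h, ENNReal.mul_top (by simp [ENNReal.rpow_eq_zero_iff]), top_le_iff] at hint
    exact ENNReal.mul_ne_top (by rw [hβ]; exact htop _)
      (ENNReal.rpow_ne_top_of_nonneg hp.le hB) hint
  calc ((2 : ℝ≥0∞) ^ (s * k) * G x) ^ p = 2 ^ (s * k * p) * G x ^ p := hpow _ _
    _ ≤ 2 ^ (s * k * p) * (C * 2 ^ (k * d) * ∫⁻ y, G y ^ p) := by
        gcongr
        exact hC k f hGint x
    _ = C * 2 ^ (k * d) * (2 ^ (s * k * p) * ∫⁻ y, G y ^ p) := by ring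
    _ ≤ C * 2 ^ (k * d) * ((((2 : ℝ≥0∞) ^ d)⁻¹) ^ k * B ^ p) := by gcongr
    _ = C * (2 ^ (((k * d : ℕ) : ℝ)) * 2 ^ (-((k * d : ℕ) : ℝ))) * B ^ p := by
        rw [hβ, ENNReal.rpow_natCast]
        ring
    _ = C * B ^ p := by rw [← hadd, add_neg_cancel, ENNReal.rpow_zero, mul_one]

theorem exists_weighted_Lam_le (L : LittlewoodPaley d) {p : ℝ} (hp : 0 < p) (s₀ s : ℝ)
    (hs : s = s₀ - d / p) :
    ∃ C : ℝ≥0, ∀ f ∈ besovSpace L (ENNReal.ofReal p) s₀ ∞, ∀ (k : ℕ) (x : Rd d),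
      (2 : ℝ≥0∞) ^ (s * k) * ‖L.Lam k f x‖ₑ ≤ C * besovNorm L (ENNReal.ofReal p) s₀ ∞ f := by
  obtain ⟨C, hC⟩ := exists_weighted_Lam_bounds L hp s₀ s hs
  refine ⟨C ^ (1 / p), fun f hf k x => ?_⟩
  have h := (ENNReal.le_rpow_inv_iff hp).2 ((hC f hf k).1 x)
  rwa [ENNReal.mul_rpow_of_nonneg _ _ (by positivity), ENNReal.rpow_rpow_inv hp.ne', ← one_div,
    ← ENNReal.coe_rpow_of_nonneg _ (by positivity)] at h

/-- The Carleson-type part of the quasi-norm of `F_∞^{s,q}`, `q < ∞`, is controlled by the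
quasi-norm of `B_p^{s₀,∞}`. -/
theorem exists_average_tsum_le (hd : 1 ≤ d) (L : LittlewoodPaley d) {p q : ℝ} (hp : 0 < p)
    (hq : 0 < q) (s₀ s : ℝ) (hs : s = s₀ - d / p) :
    ∃ C : ℝ≥0, ∀ f ∈ besovSpace L (ENNReal.ofReal p) s₀ ∞, ∀ (m : ℕ) (n : Fin d → ℤ),
      ((volume (dyadicCube (m : ℤ) n))⁻¹ *
          ∫⁻ x in dyadicCube (m : ℤ) n, ∑' k : Ici m,
            ENNReal.ofReal ((2 : ℝ) ^ (s * (k : ℕ) * q)) * ‖L.Lam (k : ℕ) f x‖ₑ ^ q) ^ (1 / q)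
        ≤ C * besovNorm L (ENNReal.ofReal p) s₀ ∞ f := by
  obtain ⟨C, hC⟩ := exists_weighted_Lam_bounds L hp s₀ s hs
  obtain ⟨D, r, hr, hD⟩ := exists_average_rpow_le (μ := (volume : Measure (Rd d))) hp hq C
  set β := ((2 : ℝ≥0∞) ^ d)⁻¹ with hβ
  -- The geometric ratio is below 1 precisely because `d ≥ 1`.
  have hβ1 : β < 1 := by
    rw [hβ, ENNReal.inv_lt_one]
    exact one_lt_pow₀ ENNReal.one_lt_two (by omega)
  have hβ0 : β ≠ 0 := by simp [hβ]
  have hβr : β ^ r < 1 := ENNReal.rpow_lt_one hβ1 hr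
  have hK : (D * (1 - β ^ r)⁻¹ : ℝ≥0∞) ≠ ∞ := ENNReal.mul_ne_top ENNReal.coe_ne_top <| by
    rw [Ne, ENNReal.inv_eq_top, tsub_eq_zero_iff_le, not_le]
    exact hβr
  have hKq : (D * (1 - β ^ r)⁻¹ : ℝ≥0∞) ^ (1 / q) ≠ ∞ :=
    ENNReal.rpow_ne_top_of_nonneg (by positivity) hK
  refine ⟨((D * (1 - β ^ r)⁻¹ : ℝ≥0∞) ^ (1 / q)).toNNReal, fun f hf m n => ?_⟩
  rw [ENNReal.coe_toNNReal hKq]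
  set B := besovNorm L (ENNReal.ofReal p) s₀ ∞ f
  set P := dyadicCube (m : ℤ) n
  have hP : volume P = β ^ m := volume_dyadicCube m n
  have hmeas : ∀ k : ℕ, Measurable fun x => (2 : ℝ≥0∞) ^ (s * k) * ‖L.Lam k f x‖ₑ := fun k =>
    (continuous_conv (L.kernel k) f).enorm.measurable.const_mul _
  have hterm : ∀ (k : ℕ) x, ENNReal.ofReal ((2 : ℝ) ^ (s * k * q)) * ‖L.Lam k f x‖ₑ ^ q
      = ((2 : ℝ≥0∞) ^ (s * k) * ‖L.Lam k f x‖ₑ) ^ q := fun k x => by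
    rw [ofReal_two_rpow, ENNReal.mul_rpow_of_nonneg _ _ hq.le, ← ENNReal.rpow_mul]
  have hk : ∀ k : Ici m, (volume P)⁻¹ *
      ∫⁻ x in P, ((2 : ℝ≥0∞) ^ (s * (k : ℕ)) * ‖L.Lam (k : ℕ) f x‖ₑ) ^ q
        ≤ D * B ^ q * (β ^ r) ^ ((k : ℕ) - m) := fun k => by
    -- As `|P| = β ^ m`, the decay `β ^ k` of the `p`-th power integral is `β ^ (k - m)` times
    -- `|P|`.
    refine (hD (ε := β ^ ((k : ℕ) - m)) (ne_of_lt hf) ?_ ?_ (hmeas k).aemeasurable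
      (hC f hf k).1 ?_).trans_eq ?_
    · rw [hP]
      exact pow_ne_zero _ hβ0
    · rw [hP]
      exact ENNReal.pow_ne_top hβ1.ne_top
    · rw [hP, ← pow_add, Nat.sub_add_cancel k.2]
      exact (hC f hf k).2
    · rw [← ENNReal.rpow_natCast, ← ENNReal.rpow_natCast, ← ENNReal.rpow_mul, ← ENNReal.rpow_mul,
        mul_comm r]
      ring
  have hinj : Function.Injective fun k : Ici m => (k : ℕ) - m := fun a b hab => by
    have ha : m ≤ (a : ℕ) := a.2
    have hb : m ≤ (b : ℕ) := b.2
    have hab' : (a : ℕ) - m = (b : ℕ) - m := hab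
    exact Subtype.ext (by omega)
  have hsum : (volume P)⁻¹ * ∫⁻ x in P, ∑' k : Ici m,
      ENNReal.ofReal ((2 : ℝ) ^ (s * (k : ℕ) * q)) * ‖L.Lam (k : ℕ) f x‖ₑ ^ q
        ≤ D * (1 - β ^ r)⁻¹ * B ^ q := by
    simp_rw [hterm]
    rw [lintegral_tsum fun k : Ici m => ((hmeas k).pow_const q).aemeasurable, ← ENNReal.tsum_mul_left]
    calc _ ≤ ∑' k : Ici m, D * B ^ q * (β ^ r) ^ ((k : ℕ) - m) := ENNReal.tsum_le_tsum hk
      _ = D * B ^ q * ∑' k : Ici m, (β ^ r) ^ ((k : ℕ) - m) := ENNReal.tsum_mul_left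
      _ ≤ D * B ^ q * ∑' j : ℕ, (β ^ r) ^ j :=
          mul_le_mul_right (ENNReal.tsum_comp_le_tsum_of_injective hinj fun j => (β ^ r) ^ j) _
      _ = _ := by
          rw [ENNReal.tsum_geometric]
          ring
  refine (ENNReal.rpow_le_rpow hsum (by positivity)).trans_eq ?_
  rw [ENNReal.mul_rpow_of_nonneg _ _ (by positivity), ← ENNReal.rpow_mul, mul_one_div_cancel hq.ne',
    ENNReal.rpow_one]

theorem exists_triebelLizorkinInftyNorm_le (hd : 1 ≤ d) (L : LittlewoodPaley d) {p : ℝ}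
    (hp : 0 < p) {q : ℝ≥0∞} (hq : 0 < q) (s₀ s : ℝ) (hs : s = s₀ - d / p) :
    ∃ C : ℝ≥0, ∀ f ∈ besovSpace L (ENNReal.ofReal p) s₀ ∞,
      triebelLizorkinInftyNorm L s q f ≤ C * besovNorm L (ENNReal.ofReal p) s₀ ∞ f := by
  obtain ⟨C, hC⟩ := exists_weighted_Lam_le L hp s₀ s hs
  rcases eq_or_ne q ∞ with rfl | hqtop
  · refine ⟨C, fun f hf => ?_⟩
    rw [triebelLizorkinInftyNorm, if_pos rfl]
    refine essSup_le_of_ae_le _ (Filter.Eventually.of_forall fun x => iSup_le fun k => ?_)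
    rw [ofReal_two_rpow]
    exact hC f hf k x
  · obtain ⟨K, hK⟩ := exists_average_tsum_le hd L hp (ENNReal.toReal_pos hq.ne' hqtop) s₀ s hs
    refine ⟨C + K, fun f hf => ?_⟩
    rw [triebelLizorkinInftyNorm, if_neg hqtop, ENNReal.coe_add, add_mul]
    refine add_le_add ?_ (iSup_le fun m => iSup_le fun _ => iSup_le fun n => hK f hf m n)
    rw [eLpNorm_exponent_top]
    refine essSup_le_of_ae_le _ (Filter.Eventually.of_forall fun x => ?_)
    -- At `k = 0` the weight `2 ^ (s k)` is 1.
    simpa using hC f hf 0 x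

end BesovTL

end

theorem theorem2p3 (d : ℕ) (hd : 1 ≤ d) (L : BesovTL.LittlewoodPaley d)
    (p₀ : ℝ) (hp₀ : 0 < p₀) (q : ℝ≥0∞) (hq : 0 < q) (s₀ s : ℝ) (hs : s = s₀ - d / p₀) :
    BesovTL.besovSpace L (ENNReal.ofReal p₀) s₀ ∞ ⊆ BesovTL.triebelLizorkinInftySpace L s q ∧
      ∃ C : ℝ≥0, ∀ f ∈ BesovTL.besovSpace L (ENNReal.ofReal p₀) s₀ ∞,
        BesovTL.triebelLizorkinInftyNorm L s q f ≤
          C * BesovTL.besovNorm L (ENNReal.ofReal p₀) s₀ ∞ f := by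
  obtain ⟨C, hC⟩ := BesovTL.exists_triebelLizorkinInftyNorm_le hd L hp₀ hq s₀ s hs
  exact ⟨fun f hf => (hC f hf).trans_lt (ENNReal.mul_lt_top ENNReal.coe_lt_top hf), C, hC⟩
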